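/- Let $\mathbb{R}^{1+3}=\mathbb{R}\times\mathbb{R}^3$ with points $(t,x)$. For $\alpha\in(-1,1)$ let $\gamma=(1-\alpha^2)^{-1/2}$ and let $L^\alpha:\mathbb{R}^{1+3}\to\mathbb{R}^{1+3}$ be the Lorentz boost $$L^\alpha(t,x_1,x_2,x_3)=(\gamma t-\gamma\alpha x_1,\ \gamma x_1-\gamma\alpha t,\ x_2,\ x_3).$$ For $F\in L^{4/3}(\mathbb{R}^{1+3})$ and $t\in\mathbb{R}$ let $$\Box^{-1}F(t,\cdot)=\int_{-\infty}^t\frac{\sin\big((t-s)\sqrt{-\Delta}\big)}{\sqrt{-\Delta}}\big(F(s,\cdot)\big)\,ds,$$ where $\sin(\tau\sqrt{-\Delta})/\sqrt{-\Delta}$ acts on tempered distributions on $\mathbb{R}^3$ as the Fourier multiplier with symbol $\sin(\tau|\xi|)/|\xi|$ (normalized so that $-\Delta$ has symbol $|\xi|^2$), and the integral in $s$ is taken in the weak sense, that is, after pairing with an arbitrary Schwartz function on $\mathbb{R}^3$. A locally integrable function $w$ on $\mathbb{R}^{1+3}$ is said to be $\Box^{-1}F$ if, for almost every $t$, $w(t,\cdot)$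 is integrable against every Schwartz function on $\mathbb{R}^3$ and equals $\Box^{-1}F(t,\cdot)$ as a distribution. Lemma 3.1. Let $F\in L^{4/3}(\mathbb{R}^{1+3})$ (complex-valued) and $\alpha\in(-1,1)$. Then the integrals defining $\Box^{-1}F(t,\cdot)$ and $\Box^{-1}(F\circ L^\alpha)(t,\cdot)$, paired with any Schwartz function, converge absolutely for every $t\in\mathbb{R}$; $\Box^{-1}F$ is a locally integrable function on $\mathbb{R}^{1+3}$; and $$\Box^{-1}(F\circ L^\alpha)=(\Box^{-1}F)\circ L^\alpha,$$ that is, if $w$ is $\Box^{-1}F$, then $w\circ L^\alpha$ is $\Box^{-1}(F\circ L^\alpha)$, and every function that is $\Box^{-1}(F\circ L^\alpha)$ equals $w\circ L^\alpha$ almost everywhere. -/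

import Mathlib

open MeasureTheory Set
open scoped ENNReal SchwartzMap

noncomputable section

namespace LorentzWave

/-- Physical space `ℝ³` with its Euclidean norm and Lebesgue measure. -/
abbrev Space := EuclideanSpace ℝ (Fin 3)

/-- Spacetime `ℝ^{1+3}`; a point is `(t, x)`. -/
abbrev Spacetime := ℝ × Space

/-! ### Lorentz boosts -/

/-- The Lorentz factor `γ = (1 - α²)^{-1/2}`. -/
def lorentzFactor (α : ℝ) : ℝ := (Real.sqrt (1 - α ^ 2))⁻¹

/-- `L^α (t, x₁, x₂, x₃) = (γ t - γ α x₁, γ x₁ - γ α t, x₂, x₃)`.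
The coordinates `x₁, x₂, x₃` are indexed by `0, 1, 2 : Fin 3`. -/
def boostMap (α : ℝ) : Spacetime →ₗ[ℝ] Spacetime where
  toFun p := (lorentzFactor α * p.1 - lorentzFactor α * α * p.2 0,
    !₂[lorentzFactor α * p.2 0 - lorentzFactor α * α * p.1, p.2 1, p.2 2])
  map_add' p q := by
    refine Prod.ext ?_ ?_
    · simp; ring
    · ext i; fin_cases i <;> simp; ring
  map_smul' c p := by
    refine Prod.ext ?_ ?_
    · simp; ring
    · ext i; fin_cases i <;> simp; ring

theorem lorentzFactor_neg (α : ℝ) : lorentzFactor (-α) = lorentzFactor α := by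
  simp [lorentzFactor]

theorem lorentzFactor_sq {α : ℝ} (hα : α ∈ Ioo (-1 : ℝ) 1) :
    lorentzFactor α ^ 2 * (1 - α ^ 2) = 1 := by
  have h : 0 < 1 - α ^ 2 := by nlinarith [hα.1, hα.2]
  rw [lorentzFactor, inv_pow, Real.sq_sqrt h.le, inv_mul_cancel₀ h.ne']

theorem boostMap_neg_boostMap {α : ℝ} (hα : α ∈ Ioo (-1 : ℝ) 1) (p : Spacetime) :
    boostMap (-α) (boostMap α p) = p := by
  have h := lorentzFactor_sq hα
  refine Prod.ext ?_ ?_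
  · simp [boostMap, lorentzFactor_neg]
    linear_combination p.1 * h
  · ext i
    fin_cases i <;> simp [boostMap, lorentzFactor_neg]
    linear_combination p.2 0 * h

/-- The boost `L^α`, `|α| < 1`, as an invertible linear map, with inverse `L^{-α}`. -/
def boost (α : ℝ) (hα : α ∈ Ioo (-1 : ℝ) 1) : Spacetime ≃L[ℝ] Spacetime :=
  LinearEquiv.toContinuousLinearEquiv
    { boostMap α with
      invFun := boostMap (-α)
      left_inv := boostMap_neg_boostMap hα
      right_inv := fun p => by
        have hα' : -α ∈ Ioo (-1 : ℝ) 1 := ⟨by linarith [hα.2], by linarith [hα.1]⟩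
        simpa using boostMap_neg_boostMap hα' p }

/-! ### The propagator `sin (t √-Δ) / √-Δ` -/

/-- The value of `sin (t √-Δ) / √-Δ` on the frequency `ξ`. For the Fourier transform
`∫ f(x) e^{-2πi x·ξ} dx`, the operator `√-Δ` is multiplication by `2π|ξ|`, so the symbol is
`sin (2πt|ξ|) / (2π|ξ|)`, with the value `t` at `ξ = 0`. -/
def waveSymbol (t : ℝ) (ξ : Space) : ℝ := t * Real.sinc (t * (2 * Real.pi * ‖ξ‖))

theorem waveSymbol_zero (t : ℝ) : waveSymbol t 0 = t := by simp [waveSymbol]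

theorem waveSymbol_of_ne_zero (t : ℝ) {ξ : Space} (hξ : ξ ≠ 0) :
    waveSymbol t ξ = Real.sin (t * (2 * Real.pi * ‖ξ‖)) / (2 * Real.pi * ‖ξ‖) := by
  have h : 2 * Real.pi * ‖ξ‖ ≠ 0 := by
    have := Real.pi_pos.ne'
    have := norm_ne_zero_iff.mpr hξ
    positivity
  rcases eq_or_ne t 0 with rfl | ht
  · simp [waveSymbol]
  · rw [waveSymbol, Real.sinc_of_ne_zero (mul_ne_zero ht h)]
    field_simp

/-- `sin (t √-Δ) / √-Δ`, acting on tempered distributions on `ℝ³` as a Fourier multiplier. -/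
def wavePropagator (t : ℝ) : 𝓢'(Space, ℂ) →L[ℂ] 𝓢'(Space, ℂ) :=
  TemperedDistribution.fourierMultiplierCLM ℂ (fun ξ => (waveSymbol t ξ : ℂ))

/-! ### The retarded solution operator -/

instance fact_one_le_four_thirds : Fact ((1 : ℝ≥0∞) ≤ 4 / 3) :=
  ⟨by
    rw [ENNReal.le_div_iff_mul_le (by simp) (by simp)]
    norm_num⟩

open Classical in
/-- The tempered distribution on `ℝ³` given by `F(s, ·)`. For `F ∈ L^{4/3}(ℝ^{1+3})` almost every
slice `F(s, ·)` lies in `L^{4/3}(ℝ³)`; the exceptional slices are set to `0`. -/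
def slice (F : Spacetime → ℂ) (s : ℝ) : 𝓢'(Space, ℂ) :=
  if h : MemLp (fun y => F (s, y)) (4 / 3) (volume : Measure Space) then
    Lp.toTemperedDistribution (h.toLp (fun y => F (s, y)))
  else 0

/-- The integrand `s ↦ ⟨sin ((t-s) √-Δ) / √-Δ (F(s, ·)), φ⟩` of the Duhamel integral, tested
against `φ`. -/
def duhamelIntegrand (F : Spacetime → ℂ) (t : ℝ) (φ : 𝓢(Space, ℂ)) (s : ℝ) : ℂ :=
  wavePropagator (t - s) (slice F s) φ

/-- `□⁻¹F(t, ·) = ∫_{-∞}^t sin ((t-s) √-Δ) / √-Δ (F(s, ·)) ds` as a distribution on `ℝ³`: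
the integral is taken in the weak sense, after pairing with a Schwartz function `φ`. -/
def antiboxAt (F : Spacetime → ℂ) (t : ℝ) (φ : 𝓢(Space, ℂ)) : ℂ :=
  ∫ s in Iio t, duhamelIntegrand F t φ s

/-- The function `w` on `ℝ^{1+3}` is `□⁻¹F`: it is locally integrable and, for almost every `t`, the
function `w(t, ·)` is the distribution `□⁻¹F(t, ·)`. -/
def IsAntibox (F w : Spacetime → ℂ) : Prop :=
  LocallyIntegrable w volume ∧
    ∀ᵐ t : ℝ, ∀ φ : 𝓢(Space, ℂ),
      Integrable (fun x => φ x * w (t, x)) ∧ ∫ x, φ x * w (t, x) = antiboxAt F t φ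

end LorentzWave

end

/-! By Kirchhoff's formula, sin(τ√-Δ)/√-Δ for τ > 0 is convolution with τ/(4π) dω carried by the
sphere of radius τ. Integrating over τ = t - s, `□⁻¹F` becomes the convolution of F with one
positive measure on the forward light cone {t = ‖y‖}, namely dy/(4π‖y‖) (`duhamel`). Convolution
with a measure invariant under a linear map commutes with that map, so everything reduces to the
boost invariance of the cone measure (`measurePreserving_boost_coneMeasure`). Writing y₁ = m sinh u
and ‖y‖ = m cosh u with m = |(y₂, y₃)|, the measure is du dy₂ dy₃/(4π), and a boost only translates
the rapidity u.

Convergence and every use of Fubini rest on one estimate. Schwartz functions are dominated by the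
weight (1 + ‖x‖²)⁻², whose wave evolution is explicit (`weightWave_eq`) and lies in L⁴((0,∞) × ℝ³).
Hölder against F ∈ L^{4/3} then gives a bound uniform in t. Both Kirchhoff's formula and the
explicit evolution come from Archimedes' theorem that a coordinate is uniformly distributed on S²
(`lintegral_sphere_inner`).

Finally, `IsAntibox F` determines its function almost everywhere (`IsAntibox.ae_eq`), which carries
the identity from the retarded potential to an arbitrary w. -/

noncomputable section

namespace LorentzWave

/-! ### Integration on ℝ³ and S²: polar and axial coordinates, Archimedes' theorem. -/

/-- The surface measure of the unit sphere of `ℝ³`. -/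
abbrev sphereMeasure : Measure (Metric.sphere (0 : Space) 1) := (volume : Measure Space).toSphere

theorem lintegral_polar {f : Space → ℝ≥0∞} (hf : Measurable f) :
    ∫⁻ x, f x = ∫⁻ r in Ioi (0 : ℝ), ENNReal.ofReal (r ^ 2) *
      ∫⁻ ω, f (r • (ω : Space)) ∂sphereMeasure := by
  have hmp := (volume : Measure Space).measurePreserving_homeomorphUnitSphereProd
  have h1 : ∫⁻ x, f x = ∫⁻ x : ({0}ᶜ : Set Space), f x ∂(volume.comap Subtype.val) := by
    rw [lintegral_subtype_comap (measurableSet_singleton (0 : Space)).compl,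
      restrict_compl_singleton]
  have hm : Measurable fun p : ℝ × Metric.sphere (0 : Space) 1 => f (p.1 • (p.2 : Space)) := by
    apply hf.comp
    fun_prop
  have h2 : ∫⁻ x : ({0}ᶜ : Set Space), f x ∂(volume.comap Subtype.val) =
      ∫⁻ p : Metric.sphere (0 : Space) 1 × Ioi (0 : ℝ), f ((p.2 : ℝ) • (p.1 : Space))
        ∂(sphereMeasure.prod (.volumeIoiPow (Module.finrank ℝ Space - 1))) := by
    rw [← hmp.lintegral_comp_emb (Homeomorph.measurableEmbedding _)]
    refine lintegral_congr fun x => ?_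
    congr 1
    have := congrArg Subtype.val ((homeomorphUnitSphereProd Space).symm_apply_apply x)
    rw [homeomorphUnitSphereProd_symm_apply_coe] at this
    exact this.symm
  rw [h1, h2, lintegral_prod_symm]
  · rw [Measure.volumeIoiPow, lintegral_withDensity_eq_lintegral_mul₀]
    · simp only [finrank_euclideanSpace, Fintype.card_fin, Nat.add_one_sub_one, Pi.mul_apply]
      exact lintegral_subtype_comap measurableSet_Ioi
        (fun r : ℝ => ENNReal.ofReal (r ^ 2) * ∫⁻ ω, f (r • (ω : Space)) ∂sphereMeasure)
    · fun_prop
    · exact ((hm.lintegral_prod_right' (ν := sphereMeasure)).comp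
        measurable_subtype_coe).aemeasurable
  · apply Measurable.aemeasurable
    apply hf.comp
    fun_prop

theorem lintegral_coords {f : Space → ℝ≥0∞} (hf : Measurable f) :
    ∫⁻ x, f x = ∫⁻ z : ℝ × ℝ, ∫⁻ a : ℝ, f !₂[a, z.1, z.2] := by
  have e1 := PiLp.volume_preserving_toLp (Fin 3)
  have e2 := (volume_preserving_piFinSuccAbove (fun _ : Fin 3 => ℝ) 0).symm
  have e3 : MeasurePreserving (Prod.map id (MeasurableEquiv.finTwoArrow (α := ℝ)).symm)
      (volume : Measure (ℝ × (ℝ × ℝ))) (volume : Measure (ℝ × (Fin 2 → ℝ))) :=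
    (MeasurePreserving.id volume).prod (volume_preserving_finTwoArrow ℝ).symm
  have e := e1.comp (e2.comp e3)
  rw [← e.lintegral_comp hf]
  rw [Measure.volume_eq_prod, lintegral_prod_symm]
  · refine lintegral_congr fun z => lintegral_congr fun a => ?_
    congr 1
    ext i
    fin_cases i <;> rfl
  · exact (hf.comp e.measurable).aemeasurable

theorem lintegral_plane_radial {G : ℝ → ℝ≥0∞} (hG : Measurable G) :
    ∫⁻ z : ℝ × ℝ, G (√(z.1 ^ 2 + z.2 ^ 2)) =
      ENNReal.ofReal (2 * Real.pi) * ∫⁻ r in Ioi (0 : ℝ), ENNReal.ofReal r * G r := by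
  rw [← lintegral_comp_polarCoord_symm, polarCoord_target, Measure.volume_eq_prod,
    ← Measure.prod_restrict]
  have : ∀ᵐ p : ℝ × ℝ ∂((volume.restrict (Ioi (0 : ℝ))).prod
      (volume.restrict (Ioo (-Real.pi) Real.pi))),
      ENNReal.ofReal p.1 • G (√((polarCoord.symm p).1 ^ 2 + (polarCoord.symm p).2 ^ 2)) =
        ENNReal.ofReal p.1 * G p.1 := by
    rw [Measure.prod_restrict]
    filter_upwards [ae_restrict_mem (measurableSet_Ioi.prod measurableSet_Ioo)] with p hp
    have h : (polarCoord.symm p).1 ^ 2 + (polarCoord.symm p).2 ^ 2 = p.1 ^ 2 := by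
      simp only [polarCoord_symm_apply]
      linear_combination p.1 ^ 2 * Real.sin_sq_add_cos_sq p.2
    rw [h, Real.sqrt_sq (le_of_lt hp.1), smul_eq_mul]
  rw [lintegral_congr_ae this, lintegral_prod _ (by fun_prop)]
  simp only [lintegral_const, Measure.restrict_apply_univ, Real.volume_Ioo]
  rw [lintegral_mul_const _ (by fun_prop), mul_comm]
  congr 2
  ring

/-- Since ρ dρ = r dr for ρ = √(a² + r²), this trades the distance to the x₁-axis for the distance
to the origin on the plane x₁ = a. -/
theorem lintegral_sqrt_sq_add {G : ℝ → ℝ≥0∞} (a : ℝ) :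
    ∫⁻ r in Ioi (0 : ℝ), ENNReal.ofReal r * G (√(a ^ 2 + r ^ 2)) =
      ∫⁻ ρ in Ioi |a|, ENNReal.ofReal ρ * G ρ := by
  have himg : (fun r : ℝ => √(a ^ 2 + r ^ 2)) '' Ioi 0 = Ioi |a| := by
    ext ρ
    simp only [mem_image, mem_Ioi]
    constructor
    · rintro ⟨r, hr, rfl⟩
      rw [← Real.sqrt_sq_eq_abs]
      exact Real.sqrt_lt_sqrt (sq_nonneg a) (by nlinarith)
    · intro h
      have h0 : a ^ 2 < ρ ^ 2 := sq_lt_sq' (by linarith [neg_abs_le a]) (by linarith [le_abs_self a])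
      refine ⟨√(ρ ^ 2 - a ^ 2), Real.sqrt_pos.2 (by linarith), ?_⟩
      rw [Real.sq_sqrt (by linarith), add_sub_cancel, Real.sqrt_sq ((abs_nonneg a).trans h.le)]
  have hpos : ∀ r ∈ Ioi (0 : ℝ), 0 < a ^ 2 + r ^ 2 := fun r hr => by
    have : 0 < r := hr
    positivity
  have hinj : InjOn (fun r : ℝ => √(a ^ 2 + r ^ 2)) (Ioi 0) := by
    intro r hr s hs h
    have := (Real.sqrt_inj (hpos r hr).le (hpos s hs).le).1 h
    have h2 : r ^ 2 = s ^ 2 := by linarith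
    exact (sq_eq_sq₀ (le_of_lt hr) (le_of_lt hs)).1 h2
  have hder : ∀ r ∈ Ioi (0 : ℝ), HasDerivWithinAt (fun r : ℝ => √(a ^ 2 + r ^ 2))
      (r / √(a ^ 2 + r ^ 2)) (Ioi 0) r := by
    intro r hr
    have h := (((hasDerivAt_id r).pow 2).const_add (a ^ 2)).sqrt (hpos r hr).ne'
    refine (h.congr_deriv ?_).hasDerivWithinAt
    simp
    field_simp
  rw [← himg, lintegral_image_eq_lintegral_abs_deriv_mul measurableSet_Ioi hder hinj]
  refine setLIntegral_congr_fun measurableSet_Ioi fun r hr => ?_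
  have hs : 0 < √(a ^ 2 + r ^ 2) := Real.sqrt_pos.2 (hpos r hr)
  have hr' : 0 < r := hr
  rw [← mul_assoc, ← ENNReal.ofReal_mul (abs_nonneg _), abs_of_pos (by positivity),
    div_mul_cancel₀ _ hs.ne']

theorem lintegral_dilate {h : ℝ → ℝ≥0∞} {ρ : ℝ} (hρ : 0 < ρ) :
    ∫⁻ a in Ioo (-ρ) ρ, h (a / ρ) = ENNReal.ofReal ρ * ∫⁻ u in Ioo (-1 : ℝ) 1, h u := by
  have himg : (fun u : ℝ => ρ * u) '' Ioo (-1) 1 = Ioo (-ρ) ρ := by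
    rw [Set.image_mul_left_Ioo hρ]
    simp
  rw [← himg, lintegral_image_eq_lintegral_abs_deriv_mul measurableSet_Ioo
    (f' := fun _ => ρ) (fun u _ => by simpa using ((hasDerivAt_id u).const_mul ρ).hasDerivWithinAt)
    (fun u _ v _ huv => mul_left_cancel₀ hρ.ne' huv)]
  rw [lintegral_const_mul' _ _ (by simp), abs_of_pos hρ]
  congr 1
  refine lintegral_congr fun u => ?_
  rw [mul_div_cancel_left₀ _ hρ.ne']

/-- The cylindrical-to-spherical change of variables for functions of `x₁` and `‖x‖`. -/
theorem lintegral_axial {H : ℝ × ℝ → ℝ≥0∞} (hH : Measurable H) :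
    ∫⁻ x : Space, H (x 0, ‖x‖) = ENNReal.ofReal (2 * Real.pi) *
      ∫⁻ ρ in Ioi (0 : ℝ), ENNReal.ofReal ρ * ∫⁻ a in Ioo (-ρ) ρ, H (a, ρ) := by
  rw [lintegral_coords (by fun_prop), lintegral_lintegral_swap]
  · have h1 : ∀ a : ℝ, ∫⁻ z : ℝ × ℝ, H ((!₂[a, z.1, z.2] : Space) 0, ‖(!₂[a, z.1, z.2] : Space)‖) =
        ENNReal.ofReal (2 * Real.pi) *
          ∫⁻ ρ, (Ioi |a|).indicator (fun ρ => ENNReal.ofReal ρ * H (a, ρ)) ρ := by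
      intro a
      rw [lintegral_indicator measurableSet_Ioi,
        ← lintegral_sqrt_sq_add (G := fun ρ => H (a, ρ)),
        ← lintegral_plane_radial (G := fun r => H (a, √(a ^ 2 + r ^ 2))) (by fun_prop)]
      refine lintegral_congr fun z => ?_
      rw [Real.sq_sqrt (by positivity), EuclideanSpace.norm_eq]
      simp [Fin.sum_univ_three, add_assoc]
    simp_rw [h1]
    have hmeas : Measurable fun p : ℝ × ℝ =>
        (Ioi |p.1|).indicator (fun ρ => ENNReal.ofReal ρ * H (p.1, ρ)) p.2 := by
      have : (fun p : ℝ × ℝ =>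
        (Ioi |p.1|).indicator (fun ρ => ENNReal.ofReal ρ * H (p.1, ρ)) p.2) =
        {p : ℝ × ℝ | |p.1| < p.2}.indicator (fun p => ENNReal.ofReal p.2 * H p) := by
        ext p
        simp [indicator]
      rw [this]
      exact Measurable.indicator (by fun_prop) (measurableSet_lt (by fun_prop) (by fun_prop))
    rw [lintegral_const_mul' _ _ ENNReal.ofReal_ne_top, lintegral_lintegral_swap hmeas.aemeasurable]
    congr 1
    rw [← lintegral_indicator measurableSet_Ioi]
    refine lintegral_congr fun ρ => ?_
    by_cases hρ : 0 < ρ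
    · rw [indicator_of_mem (by exact hρ), ← lintegral_const_mul' _ _ (by simp),
        ← lintegral_indicator measurableSet_Ioo]
      refine lintegral_congr fun a => ?_
      by_cases ha : |a| < ρ
      · rw [indicator_of_mem (by exact ha), indicator_of_mem (mem_Ioo.2 (abs_lt.1 ha))]
      · rw [indicator_of_notMem (by exact ha),
          indicator_of_notMem (fun h => ha (abs_lt.2 (mem_Ioo.1 h)))]
    · rw [indicator_of_notMem (by exact hρ)]
      refine (lintegral_congr fun a => ?_).trans lintegral_zero
      exact indicator_of_notMem (fun h => hρ ((abs_nonneg a).trans_lt h)) _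
  · apply Measurable.aemeasurable
    apply hH.comp
    have : Measurable fun p : (ℝ × ℝ) × ℝ => (!₂[p.2, p.1.1, p.1.2] : Space) := by
      apply (WithLp.measurable_toLp 2 _).comp
      refine measurable_pi_lambda _ fun i => ?_
      fin_cases i <;> simp <;> fun_prop
    exact ((by fun_prop : Measurable fun x : Space => (x 0, ‖x‖))).comp this

/-- A reflection exchanges two vectors of equal length, here ‖ξ‖e₁ and ξ; the case ξ = 0 needs no
separate treatment. -/
theorem exists_isometry_inner_eq (ξ : Space) :
    ∃ R : Space ≃ₗᵢ[ℝ] Space, ∀ x, inner ℝ (R x) ξ = ‖ξ‖ * x 0 := by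
  obtain ⟨R, h⟩ : ∃ R : Space ≃ₗᵢ[ℝ] Space,
      R (‖ξ‖ • EuclideanSpace.single (0 : Fin 3) (1 : ℝ)) = ξ :=
    ⟨_, Submodule.reflection_sub (by simp [norm_smul])⟩
  refine ⟨R, fun x => ?_⟩
  conv_lhs => rw [← h]
  rw [LinearIsometryEquiv.inner_map_map, inner_smul_right, EuclideanSpace.inner_single_right]
  simp

/-- Archimedes: the projection of S² to a diameter is uniform. The degree-zero homogeneous function
h(⟨x, ξ⟩/‖x‖) is integrated over the unit ball in two ways, in polar coordinates and, after rotating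
ξ to the x₁-axis, in axial coordinates. -/
theorem lintegral_sphere_inner {h : ℝ → ℝ≥0∞} (hh : Measurable h) (ξ : Space) :
    ∫⁻ ω, h (inner ℝ (ω : Space) ξ) ∂sphereMeasure =
      ENNReal.ofReal (2 * Real.pi) * ∫⁻ u in Ioo (-1 : ℝ) 1, h (‖ξ‖ * u) := by
  -- The radial factor ∫₀¹ r² dr = 1/3 appears in both computations; being neither 0 nor ∞, it
  -- cancels.
  let c : ℝ≥0∞ := ∫⁻ r in Ioi (0 : ℝ), ENNReal.ofReal (r ^ 2) * (Iio (1 : ℝ)).indicator 1 r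
  have hc : c = ENNReal.ofReal (1 / 3) := by
    have : c = ∫⁻ r in Ioc (0 : ℝ) 1, ENNReal.ofReal (r ^ 2) := by
      rw [← restrict_Ioo_eq_restrict_Ioc, ← Ioi_inter_Iio, inter_comm,
        ← Measure.restrict_restrict measurableSet_Iio, ← lintegral_indicator measurableSet_Iio]
      refine lintegral_congr fun r => ?_
      by_cases hr : r ∈ Iio (1 : ℝ) <;> simp [hr]
    rw [this, ← ofReal_integral_eq_lintegral_ofReal (intervalIntegral.intervalIntegrable_pow _).1
      (ae_of_all _ fun r => sq_nonneg r), ← intervalIntegral.integral_of_le zero_le_one]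
    norm_num
  let f : Space → ℝ≥0∞ := fun x => (Iio (1 : ℝ)).indicator 1 ‖x‖ * h (inner ℝ x ξ / ‖x‖)
  have hi : Measurable ((Iio (1 : ℝ)).indicator (1 : ℝ → ℝ≥0∞)) :=
    measurable_one.indicator measurableSet_Iio
  have hf : Measurable f := by
    refine (hi.comp measurable_norm).mul (hh.comp ?_)
    fun_prop
  have h1 : ∫⁻ x, f x = c * ∫⁻ ω, h (inner ℝ (ω : Space) ξ) ∂sphereMeasure := by
    rw [lintegral_polar hf, ← lintegral_mul_const _ (by fun_prop)]
    refine setLIntegral_congr_fun measurableSet_Ioi fun r hr => ?_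
    have hr : 0 < r := hr
    have : ∀ ω : Metric.sphere (0 : Space) 1, f (r • (ω : Space)) =
        (Iio (1 : ℝ)).indicator 1 r * h (inner ℝ (ω : Space) ξ) := by
      intro ω
      have hω : ‖(ω : Space)‖ = 1 := by simp
      simp only [f, norm_smul, hω, Real.norm_eq_abs, abs_of_pos hr, mul_one,
        real_inner_smul_left]
      rw [mul_div_cancel_left₀ _ hr.ne']
    simp_rw [this]
    rw [lintegral_const_mul' _ _ (by simp [indicator]; split_ifs <;> simp), mul_assoc]
  obtain ⟨R, hR⟩ := exists_isometry_inner_eq ξ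
  have h2 : ∫⁻ x, f x = c *
      (ENNReal.ofReal (2 * Real.pi) * ∫⁻ u in Ioo (-1 : ℝ) 1, h (‖ξ‖ * u)) := by
    rw [← R.measurePreserving.lintegral_comp hf]
    simp only [f, hR, LinearIsometryEquiv.norm_map]
    rw [lintegral_axial
      (H := fun p => (Iio (1 : ℝ)).indicator 1 p.2 * h (‖ξ‖ * p.1 / p.2))
      ((hi.comp measurable_snd).mul (hh.comp (by fun_prop))), mul_left_comm,
      ← lintegral_mul_const _ (by fun_prop)]
    congr 1
    refine setLIntegral_congr_fun measurableSet_Ioi fun ρ hρ => ?_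
    have hρ : 0 < ρ := hρ
    simp only [mul_div_assoc]
    rw [lintegral_const_mul' _ _ (by simp [indicator]; split_ifs <;> simp),
      lintegral_dilate (h := fun u => h (‖ξ‖ * u)) hρ, pow_two, ENNReal.ofReal_mul hρ.le]
    ring
  rw [h1] at h2
  refine (ENNReal.mul_right_inj ?_ ?_).1 h2 <;> rw [hc] <;> simp

theorem map_inner_sphereMeasure (ξ : Space) :
    sphereMeasure.map (fun ω : Metric.sphere (0 : Space) 1 => inner ℝ (ω : Space) ξ) =
      (ENNReal.ofReal (2 * Real.pi) • volume.restrict (Ioo (-1 : ℝ) 1)).map (fun u => ‖ξ‖ * u) := by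
  refine Measure.ext_of_lintegral _ fun h hh => ?_
  rw [lintegral_map hh (by fun_prop), lintegral_map hh (by fun_prop), lintegral_smul_measure,
    lintegral_sphere_inner hh, smul_eq_mul]

theorem integral_sphere_inner {E : Type*} [NormedAddCommGroup E] [NormedSpace ℝ E] {h : ℝ → E}
    (hh : StronglyMeasurable h) (ξ : Space) :
    ∫ ω, h (inner ℝ (ω : Space) ξ) ∂sphereMeasure =
      (2 * Real.pi) • ∫ u in Ioo (-1 : ℝ) 1, h (‖ξ‖ * u) := by
  rw [← integral_map (f := h) (φ := fun ω : Metric.sphere (0 : Space) 1 => inner ℝ (ω : Space) ξ)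
    (by fun_prop) hh.aestronglyMeasurable, map_inner_sphereMeasure,
    integral_map (by fun_prop) hh.aestronglyMeasurable, integral_smul_measure,
    ENNReal.toReal_ofReal (by positivity)]

/-! ### Kirchhoff's formula. -/

open FourierTransform

/-- Uniform measure of mass `4π` on the sphere of radius `r` in `ℝ³`. -/
def dilatedSphereMeasure (r : ℝ) : Measure Space :=
  sphereMeasure.map (fun ω : Metric.sphere (0 : Space) 1 => r • (ω : Space))

instance (r : ℝ) : IsFiniteMeasure (dilatedSphereMeasure r) := by
  unfold dilatedSphereMeasure
  infer_instance

theorem norm_ae_dilatedSphereMeasure (r : ℝ) : ∀ᵐ v ∂(dilatedSphereMeasure r), ‖v‖ = |r| := by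
  rw [dilatedSphereMeasure,
    ae_map_iff (by fun_prop) (measurableSet_eq_fun (by fun_prop) (by fun_prop))]
  refine ae_of_all _ fun ω => ?_
  simp [norm_smul]

theorem integral_dilatedSphereMeasure {E : Type*} [NormedAddCommGroup E] [NormedSpace ℝ E]
    {f : Space → E} (hf : Continuous f) (r : ℝ) :
    ∫ v, f v ∂(dilatedSphereMeasure r) = ∫ ω, f (r • (ω : Space)) ∂sphereMeasure := by
  rw [dilatedSphereMeasure, integral_map (by fun_prop) hf.aestronglyMeasurable]

/-- The Fourier transform of a finite measure. -/
def measureFourier (μ : Measure Space) (ξ : Space) : ℂ :=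
  VectorFourier.fourierIntegral 𝐞 μ (innerSL ℝ (E := Space)).toLinearMap₁₂ (fun _ => (1 : ℂ)) ξ

theorem measureFourier_apply (μ : Measure Space) (ξ : Space) :
    measureFourier μ ξ = ∫ v, (𝐞 (-(inner ℝ v ξ)) : ℂ) ∂μ := by
  simp [measureFourier, VectorFourier.fourierIntegral, Circle.smul_def]

/-- A finite measure of bounded support has all moments, so its Fourier transform is smooth with
every derivative bounded. This makes it an admissible multiplier on Schwartz functions. -/
theorem hasTemperateGrowth_measureFourier {μ : Measure Space} [IsFiniteMeasure μ] {R : ℝ}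
    (hR : ∀ᵐ v ∂μ, ‖v‖ ≤ R) : (measureFourier μ).HasTemperateGrowth := by
  have hint : ∀ n : ℕ, Integrable (fun v : Space => ‖v‖ ^ n * ‖(1 : ℂ)‖) μ := by
    intro n
    refine Integrable.of_bound (by fun_prop) (R ^ n) ?_
    filter_upwards [hR] with v hv
    simp only [norm_one, mul_one, norm_pow, norm_norm]
    gcongr
  have hm : AEStronglyMeasurable (fun _ : Space => (1 : ℂ)) μ := aestronglyMeasurable_const
  refine ⟨VectorFourier.contDiff_fourierIntegral (N := ⊤) _ fun n _ => hint n, fun n => ?_⟩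
  refine ⟨0, ∫ v, ‖VectorFourier.fourierPowSMulRight (innerSL ℝ (E := Space))
    (fun _ => (1 : ℂ)) v n‖ ∂μ, fun ξ => ?_⟩
  · rw [pow_zero, mul_one]
    have := VectorFourier.iteratedFDeriv_fourierIntegral (innerSL ℝ (E := Space)) (N := ⊤)
      (fun n _ => hint n) hm (n := n) le_top
    unfold measureFourier
    rw [this]
    exact VectorFourier.norm_fourierIntegral_le_integral_norm _ _ _ _ _

/-- By Archimedes, the spherical Fourier integral is 2π ∫₋₁¹ e^{-2πiτ‖ξ‖u} du, which is 4π times the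
sinc in the symbol. -/
theorem waveSymbol_eq_measureFourier {τ : ℝ} (ξ : Space) :
    (waveSymbol τ ξ : ℂ) =
      ((τ / (4 * Real.pi) : ℝ) : ℂ) • measureFourier (dilatedSphereMeasure τ) ξ := by
  rw [measureFourier_apply, integral_dilatedSphereMeasure (by fun_prop)]
  simp only [real_inner_smul_left]
  rw [integral_sphere_inner (h := fun u => (𝐞 (-(τ * u)) : ℂ))
    (by fun_prop : Continuous fun u : ℝ => (𝐞 (-(τ * u)) : ℂ)).stronglyMeasurable ξ]
  have h1 : ∫ u in Ioo (-1 : ℝ) 1, (𝐞 (-(τ * (‖ξ‖ * u))) : ℂ) =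
      2 * (Real.sinc (τ * (2 * Real.pi * ‖ξ‖)) : ℂ) := by
    rw [← integral_Ioc_eq_integral_Ioo, ← intervalIntegral.integral_of_le (by norm_num)]
    set d : ℝ := -(τ * (2 * Real.pi * ‖ξ‖)) with hd
    have h2 : ∀ u : ℝ, (𝐞 (-(τ * (‖ξ‖ * u))) : ℂ) =
        (fun t : ℝ => Complex.exp (t * Complex.I)) (d * u) := by
      intro u
      rw [Real.fourierChar_apply, hd]
      congr 2
      push_cast
      ring
    have h3 : Real.sinc (τ * (2 * Real.pi * ‖ξ‖)) = Real.sinc d := by rw [hd, Real.sinc_neg]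
    simp_rw [h2]
    rw [h3]
    -- The substitution t = du divides by d, so zero frequency or zero time is handled apart.
    rcases eq_or_ne d 0 with h0 | h0
    · rw [h0]
      simp
      norm_num
    · rw [intervalIntegral.integral_comp_mul_left (fun t : ℝ => Complex.exp (t * Complex.I)) h0,
        mul_neg, mul_one, integral_exp_mul_I_eq_sinc, Complex.real_smul]
      push_cast
      have : (d : ℂ) ≠ 0 := by exact_mod_cast h0
      field_simp
  rw [h1, waveSymbol]
  push_cast
  have : (Real.pi : ℂ) ≠ 0 := by exact_mod_cast Real.pi_ne_zero
  rw [Complex.real_smul, smul_eq_mul]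
  push_cast
  field_simp
  ring

/-- Multiplication by the Fourier transform of a measure is convolution with the measure. -/
theorem fourier_smulLeft_measureFourier {μ : Measure Space} [IsFiniteMeasure μ]
    (hμ : (measureFourier μ).HasTemperateGrowth) (φ : 𝓢(Space, ℂ)) (y : Space) :
    𝓕 (SchwartzMap.smulLeftCLM ℂ (measureFourier μ) (𝓕⁻ φ)) y = ∫ v, φ (y + v) ∂μ := by
  rw [SchwartzMap.fourier_coe, Real.fourier_eq]
  simp only [SchwartzMap.smulLeftCLM_apply_apply hμ, measureFourier_apply, Circle.smul_def,
    smul_eq_mul]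
  have hψ : Integrable (𝓕⁻ φ : 𝓢(Space, ℂ)) volume := SchwartzMap.integrable _
  calc ∫ ξ, (𝐞 (-(inner ℝ ξ y)) : ℂ) * ((∫ v, (𝐞 (-(inner ℝ v ξ)) : ℂ) ∂μ) * (𝓕⁻ φ) ξ)
      = ∫ ξ, ∫ v, (𝐞 (-(inner ℝ ξ y)) : ℂ) * ((𝐞 (-(inner ℝ v ξ)) : ℂ) * (𝓕⁻ φ) ξ) ∂μ := by
        refine integral_congr_ae (ae_of_all _ fun ξ => ?_)
        simp only
        rw [← integral_mul_const, ← integral_const_mul]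
    _ = ∫ v, (∫ ξ, (𝐞 (-(inner ℝ ξ y)) : ℂ) * ((𝐞 (-(inner ℝ v ξ)) : ℂ) * (𝓕⁻ φ) ξ)) ∂μ := by
        apply integral_integral_swap
        refine (hψ.comp_fst μ).mono (Continuous.aestronglyMeasurable ?_) (ae_of_all _ fun p => ?_)
        · have := (𝓕⁻ φ : 𝓢(Space, ℂ)).continuous
          fun_prop
        · simp only [Function.uncurry, norm_mul, Circle.norm_coe, one_mul, le_refl]
    _ = ∫ v, φ (y + v) ∂μ := by
        refine integral_congr_ae (ae_of_all _ fun v => ?_)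
        have h : φ (y + v) = 𝓕 (𝓕⁻ φ) (y + v) := by
          rw [FourierTransform.fourier_fourierInv_eq]
        simp only
        rw [h, SchwartzMap.fourier_coe, Real.fourier_eq]
        refine integral_congr_ae (ae_of_all _ fun ξ => ?_)
        simp only [inner_add_right, neg_add, AddChar.map_add_eq_mul, Circle.smul_def, smul_eq_mul,
          Circle.coe_mul, real_inner_comm v ξ]
        ring

/-- Kirchhoff's formula: the function `sin (τ √-Δ) / √-Δ φ`. -/
def kirchhoff (φ : Space → ℂ) (τ : ℝ) (y : Space) : ℂ :=
  ((τ / (4 * Real.pi) : ℝ) : ℂ) * ∫ ω, φ (y + τ • (ω : Space)) ∂sphereMeasure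

/-- The multiplier acts on distributions by duality. The existential records that the Kirchhoff mean
of φ is itself a Schwartz function, which comes for free from the Fourier side. -/
theorem wavePropagator_apply (τ : ℝ) (u : 𝓢'(Space, ℂ)) (φ : 𝓢(Space, ℂ)) :
    ∃ ψ : 𝓢(Space, ℂ), wavePropagator τ u φ = u ψ ∧ ∀ y, ψ y = kirchhoff φ τ y := by
  refine ⟨_, TemperedDistribution.fourierMultiplierCLM_apply_apply _ _ _, fun y => ?_⟩
  have hμ := hasTemperateGrowth_measureFourier (μ := dilatedSphereMeasure τ) (R := |τ|)
    ((norm_ae_dilatedSphereMeasure τ).mono fun v hv => hv.le)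
  have h1 : (fun ξ => (waveSymbol τ ξ : ℂ)) =
      ((τ / (4 * Real.pi) : ℝ) : ℂ) • measureFourier (dilatedSphereMeasure τ) :=
    funext fun ξ => waveSymbol_eq_measureFourier ξ
  rw [h1, SchwartzMap.smulLeftCLM_smul hμ, smul_apply,
    FourierTransform.fourier_smul, smul_apply, fourier_smulLeft_measureFourier hμ,
    kirchhoff, integral_dilatedSphereMeasure (by have := φ.continuous; fun_prop), smul_eq_mul]

theorem wavePropagator_toLp {f : Space → ℂ} (hf : MemLp f (4 / 3) volume) (τ : ℝ)
    (φ : 𝓢(Space, ℂ)) :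
    wavePropagator τ (Lp.toTemperedDistribution (hf.toLp f)) φ =
      ∫ y, kirchhoff φ τ y * f y := by
  obtain ⟨ψ, h1, h2⟩ := wavePropagator_apply τ (Lp.toTemperedDistribution (hf.toLp f)) φ
  rw [h1, Lp.toTemperedDistribution_apply]
  refine integral_congr_ae ?_
  filter_upwards [hf.coeFn_toLp] with y hy
  rw [hy, h2, smul_eq_mul]

/-! ### The light-cone measure and its Lorentz invariance. -/

/-- The measure `τ/(4π) dτ dω` on `(0, ∞) × S²`. -/
def conePolarMeasure : Measure (ℝ × Metric.sphere (0 : Space) 1) :=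
  ((volume.restrict (Ioi (0 : ℝ))).withDensity
    (fun τ => ENNReal.ofReal (τ / (4 * Real.pi)))).prod sphereMeasure

instance : SFinite conePolarMeasure := by
  unfold conePolarMeasure
  infer_instance

/-- The invariant measure `dy/(4π‖y‖)` of the forward light cone `{(‖y‖, y)}`, which is the forward
fundamental solution of the wave operator. -/
def coneMeasure : Measure Spacetime :=
  conePolarMeasure.map (fun p => (p.1, p.1 • (p.2 : Space)))

instance : SFinite coneMeasure := by
  unfold coneMeasure
  infer_instance

theorem lintegral_conePolarMeasure {f : ℝ × Metric.sphere (0 : Space) 1 → ℝ≥0∞}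
    (hf : Measurable f) :
    ∫⁻ p, f p ∂conePolarMeasure = ∫⁻ τ in Ioi (0 : ℝ), ENNReal.ofReal (τ / (4 * Real.pi)) *
      ∫⁻ ω, f (τ, ω) ∂sphereMeasure := by
  rw [conePolarMeasure, lintegral_prod _ hf.aemeasurable,
    lintegral_withDensity_eq_lintegral_mul _ (by fun_prop) hf.lintegral_prod_right']
  rfl

theorem lintegral_coneMeasure {f : Spacetime → ℝ≥0∞} (hf : Measurable f) :
    ∫⁻ p, f p ∂coneMeasure = ∫⁻ τ in Ioi (0 : ℝ), ENNReal.ofReal (τ / (4 * Real.pi)) *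
      ∫⁻ ω, f (τ, τ • (ω : Space)) ∂sphereMeasure := by
  rw [coneMeasure, lintegral_map hf (by fun_prop),
    lintegral_conePolarMeasure (by fun_prop)]

theorem lintegral_coneMeasure_eq_space {f : Spacetime → ℝ≥0∞} (hf : Measurable f) :
    ∫⁻ p, f p ∂coneMeasure =
      ∫⁻ y : Space, ENNReal.ofReal (1 / (4 * Real.pi * ‖y‖)) * f (‖y‖, y) := by
  rw [lintegral_coneMeasure hf, lintegral_polar (by fun_prop)]
  refine setLIntegral_congr_fun measurableSet_Ioi fun r hr => ?_
  have hr : 0 < r := hr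
  have h : ∀ ω : Metric.sphere (0 : Space) 1, ‖r • (ω : Space)‖ = r := fun ω => by
    simp [norm_smul, abs_of_pos hr]
  simp only [h]
  rw [lintegral_const_mul' _ _ ENNReal.ofReal_ne_top, ← mul_assoc,
    ← ENNReal.ofReal_mul (sq_nonneg r)]
  congr 2
  field_simp

theorem lintegral_sinh_substitution (g : ℝ → ℝ≥0∞) {m : ℝ} (hm : 0 < m) :
    ∫⁻ a, g a = ∫⁻ u, ENNReal.ofReal (m * Real.cosh u) * g (m * Real.sinh u) := by
  have himg : (fun u : ℝ => m * Real.sinh u) '' univ = univ := by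
    rw [image_univ, range_eq_univ]
    exact (mul_left_surjective₀ hm.ne').comp Real.sinh_surjective
  rw [← setLIntegral_univ, ← himg, lintegral_image_eq_lintegral_abs_deriv_mul MeasurableSet.univ
    (fun u _ => ((Real.hasDerivAt_sinh u).const_mul m).hasDerivWithinAt)
    (fun u _ v _ h => Real.sinh_injective (mul_left_cancel₀ hm.ne' h)), setLIntegral_univ]
  simp_rw [abs_of_pos (mul_pos hm (Real.cosh_pos _))]

/-- With m = |(y₂, y₃)| fixed, y₁ = m sinh u gives ‖y‖ = m cosh u, hence dy₁/‖y‖ = du: the singular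
density disappears. -/
theorem lintegral_coneMeasure_rapidity {f : Spacetime → ℝ≥0∞} (hf : Measurable f) :
    ∫⁻ p, f p ∂coneMeasure = ∫⁻ z : ℝ × ℝ, ∫⁻ u : ℝ, ENNReal.ofReal (1 / (4 * Real.pi)) *
      f (√(z.1 ^ 2 + z.2 ^ 2) * Real.cosh u,
        !₂[√(z.1 ^ 2 + z.2 ^ 2) * Real.sinh u, z.1, z.2]) := by
  rw [lintegral_coneMeasure_eq_space hf, lintegral_coords (by fun_prop)]
  refine lintegral_congr_ae ?_
  -- The axis m = 0, where the substitution degenerates, is a null set.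
  have hz : ∀ᵐ z : ℝ × ℝ, z ≠ 0 := by
    simp [ae_iff, measure_singleton]
  filter_upwards [hz] with z hz
  have hpos : 0 < z.1 ^ 2 + z.2 ^ 2 := by
    rcases z with ⟨b, c⟩
    by_contra h
    apply hz
    have hb : b = 0 := by nlinarith [sq_nonneg b, sq_nonneg c]
    have hc : c = 0 := by nlinarith [sq_nonneg b, sq_nonneg c]
    simp [hb, hc]
  set m := √(z.1 ^ 2 + z.2 ^ 2) with hm
  have hm0 : 0 < m := Real.sqrt_pos.2 hpos
  have hmsq : m ^ 2 = z.1 ^ 2 + z.2 ^ 2 := Real.sq_sqrt hpos.le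
  rw [lintegral_sinh_substitution _ hm0]
  refine lintegral_congr fun u => ?_
  have hnorm : ‖(!₂[m * Real.sinh u, z.1, z.2] : Space)‖ = m * Real.cosh u := by
    rw [EuclideanSpace.norm_eq, ← Real.sqrt_sq (mul_pos hm0 (Real.cosh_pos u)).le]
    congr 1
    simp only [Fin.sum_univ_three, Real.norm_eq_abs, sq_abs]
    simp only [Matrix.cons_val]
    linear_combination -hmsq + m ^ 2 * (-Real.cosh_sq u)
  have hc := Real.cosh_pos u
  rw [hnorm, ← mul_assoc, ← ENNReal.ofReal_mul (by positivity)]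
  congr 2
  field_simp

/-- The boost fixes y₂, y₃ and sends rapidity u to u - b, so the claim is translation invariance of
du. -/
theorem measurePreserving_boost_coneMeasure {α : ℝ} (hα : α ∈ Ioo (-1 : ℝ) 1) :
    MeasurePreserving (boost α hα) coneMeasure coneMeasure := by
  have hmeas : Measurable (boost α hα) := (boost α hα).continuous.measurable
  refine ⟨hmeas, Measure.ext_of_lintegral _ fun f hf => ?_⟩
  rw [lintegral_map hf hmeas, lintegral_coneMeasure_rapidity (f := fun p => f (boost α hα p))
      (hf.comp hmeas),
    lintegral_coneMeasure_rapidity hf]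
  refine lintegral_congr fun z => ?_
  set m := √(z.1 ^ 2 + z.2 ^ 2)
  -- The rapidity of the boost: sinh b = γα, and then cosh b = γ because γ² - γ²α² = 1.
  set b := Real.arsinh (lorentzFactor α * α)
  have hγ : 0 ≤ lorentzFactor α := inv_nonneg.2 (Real.sqrt_nonneg _)
  have hs : Real.sinh b = lorentzFactor α * α := Real.sinh_arsinh _
  have hc : Real.cosh b = lorentzFactor α := by
    rw [Real.cosh_arsinh, ← Real.sqrt_sq hγ]
    congr 1
    rw [Real.sqrt_sq hγ]
    linear_combination -lorentzFactor_sq hα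
  rw [← lintegral_add_right_eq_self _ b]
  refine lintegral_congr fun u => ?_
  have hcosh : Real.cosh u = lorentzFactor α * Real.cosh (u + b) -
      lorentzFactor α * α * Real.sinh (u + b) := by
    conv_lhs => rw [← add_sub_cancel_right u b, Real.cosh_sub, hs, hc]
    ring
  have hsinh : Real.sinh u = lorentzFactor α * Real.sinh (u + b) -
      lorentzFactor α * α * Real.cosh (u + b) := by
    conv_lhs => rw [← add_sub_cancel_right u b, Real.sinh_sub, hs, hc]
    ring
  congr 2
  change boostMap α _ = _
  refine Prod.ext ?_ ?_
  · simp only [boostMap, LinearMap.coe_mk, AddHom.coe_mk, hcosh, Matrix.cons_val]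
    ring
  · ext i
    fin_cases i
    · simp [boostMap, hsinh]
      ring
    · simp [boostMap]
    · simp [boostMap]

/-! ### The convergence estimate: wave evolution of the weight and Hölder's inequality. -/

/-- The weight `(1 + ‖x‖²)⁻²`, which dominates Schwartz functions. -/
def weight (x : Space) : ℝ≥0∞ := ENNReal.ofReal ((1 + ‖x‖ ^ 2) ^ 2)⁻¹

theorem measurable_weight : Measurable weight := by
  unfold weight
  fun_prop

theorem exists_enorm_le_weight (φ : 𝓢(Space, ℂ)) :
    ∃ C : ℝ≥0∞, C ≠ ∞ ∧ ∀ x, ‖φ x‖ₑ ≤ C * weight x := by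
  let C := 2 ^ 4 * ((Finset.Iic (4, 0)).sup fun m => SchwartzMap.seminorm ℝ m.1 m.2) φ
  have hC : ∀ x, (1 + ‖x‖) ^ 4 * ‖φ x‖ ≤ C := fun x => by
    have := SchwartzMap.one_add_le_sup_seminorm_apply (𝕜 := ℝ) (m := (4, 0)) le_rfl le_rfl φ x
    simpa using this
  have hC0 : 0 ≤ C := le_trans (by positivity) (hC 0)
  refine ⟨ENNReal.ofReal C, ENNReal.ofReal_ne_top, fun x => ?_⟩
  rw [weight, ← ENNReal.ofReal_mul hC0, ← ofReal_norm]
  refine ENNReal.ofReal_le_ofReal ?_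
  rw [← div_eq_mul_inv, le_div_iff₀ (by positivity)]
  refine le_trans ?_ (hC x)
  rw [mul_comm]
  gcongr
  calc (1 + ‖x‖ ^ 2) ^ 2 ≤ ((1 + ‖x‖) ^ 2) ^ 2 := by
        gcongr
        nlinarith [norm_nonneg x]
    _ = (1 + ‖x‖) ^ 4 := by ring

/-- The solution of the wave equation with initial velocity `weight`. -/
def weightWave (p : Spacetime) : ℝ≥0∞ :=
  ENNReal.ofReal (p.1 / (4 * Real.pi)) *
    ∫⁻ ω, weight (p.2 + p.1 • (ω : Space)) ∂sphereMeasure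

theorem measurable_weightWave : Measurable weightWave := by
  refine Measurable.mul (by fun_prop) ?_
  have : Measurable fun q : Spacetime × Metric.sphere (0 : Space) 1 =>
      weight (q.1.2 + q.1.1 • (q.2 : Space)) := measurable_weight.comp (by fun_prop)
  exact this.lintegral_prod_right'

/-- The antiderivative u/(A(A + Bu)) is used instead of -1/(B(A + Bu)) because it remains valid at B
= 0. -/
theorem integral_inv_sq_affine {A B : ℝ} (h : |B| < A) :
    ∫ u in (-1 : ℝ)..1, ((A + B * u) ^ 2)⁻¹ = 2 / (A ^ 2 - B ^ 2) := by
  have hA : 0 < A := (abs_nonneg B).trans_lt h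
  have hpos : ∀ u ∈ uIcc (-1 : ℝ) 1, 0 < A + B * u := by
    intro u hu
    rw [uIcc_of_le (by norm_num)] at hu
    have : |B * u| ≤ |B| := by
      rw [abs_mul]
      exact mul_le_of_le_one_right (abs_nonneg B) (abs_le.2 hu)
    linarith [neg_abs_le (B * u)]
  have hder : ∀ u ∈ uIcc (-1 : ℝ) 1,
      HasDerivAt (fun u => u / (A * (A + B * u))) ((A + B * u) ^ 2)⁻¹ u := by
    intro u hu
    have hp := hpos u hu
    have := (hasDerivAt_id u).div ((((hasDerivAt_id u).const_mul B).const_add A).const_mul A)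
      (by simpa using ⟨hA.ne', hp.ne'⟩)
    refine this.congr_deriv ?_
    simp only [id]
    field_simp
    ring
  have h1 := abs_lt.1 h
  have h2 : A + B ≠ 0 := by linarith
  have h3 : A - B ≠ 0 := by linarith
  rw [intervalIntegral.integral_eq_sub_of_hasDerivAt hder]
  · have h4 : A ^ 2 - B ^ 2 ≠ 0 := by
      rw [sq_sub_sq]
      exact mul_ne_zero h2 h3
    have h5 : A + B * (-1) ≠ 0 := by linarith
    rw [show A + B * (-1) = A - B by ring, show A ^ 2 - B ^ 2 = (A + B) * (A - B) by ring]
    field_simp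
    ring
  · apply ContinuousOn.intervalIntegrable
    apply ContinuousOn.inv₀ (by fun_prop)
    intro u hu
    exact (pow_pos (hpos u hu) 2).ne'

/-- On the sphere of radius τ about y, 1 + ‖y + τω‖² is affine in ⟨ω, y⟩. Archimedes thus reduces
the spherical mean to an elementary integral, and the resulting difference of squares factors. -/
theorem weightWave_eq {τ : ℝ} (hτ : 0 < τ) (y : Space) :
    weightWave (τ, y) =
      ENNReal.ofReal (τ / ((1 + (‖y‖ - τ) ^ 2) * (1 + (‖y‖ + τ) ^ 2))) := by
  set A : ℝ := 1 + ‖y‖ ^ 2 + τ ^ 2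
  have h1 : ∀ ω : Metric.sphere (0 : Space) 1, weight (y + τ • (ω : Space)) =
      (fun u => ENNReal.ofReal ((A + 2 * τ * u) ^ 2)⁻¹) (inner ℝ (ω : Space) y) := by
    intro ω
    have hω : ‖(ω : Space)‖ = 1 := by simp
    have : ‖y + τ • (ω : Space)‖ ^ 2 = ‖y‖ ^ 2 + 2 * τ * inner ℝ (ω : Space) y + τ ^ 2 := by
      rw [norm_add_sq_real, norm_smul, hω, real_inner_smul_right, real_inner_comm]
      simp
      ring
    simp only [weight, this, A]
    congr 3
    ring
  have hB : |2 * τ * ‖y‖| < A := by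
    rw [abs_of_nonneg (by positivity)]
    simp only [A]
    nlinarith [sq_nonneg (‖y‖ - τ)]
  have h2 : ∫⁻ u in Ioo (-1 : ℝ) 1, ENNReal.ofReal ((A + 2 * τ * (‖y‖ * u)) ^ 2)⁻¹ =
      ENNReal.ofReal (2 / (A ^ 2 - (2 * τ * ‖y‖) ^ 2)) := by
    have hI := integral_inv_sq_affine hB
    rw [← hI, intervalIntegral.integral_of_le (by norm_num), ofReal_integral_eq_lintegral_ofReal,
      restrict_Ioo_eq_restrict_Ioc]
    · simp only [mul_assoc]
    -- The Bochner integral of a non-integrable function is 0 by convention, while this one has a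
    -- positive value; integrability follows.
    · by_contra hc
      rw [intervalIntegral.integral_of_le (by norm_num), integral_undef hc] at hI
      have : 0 < 2 / (A ^ 2 - (2 * τ * ‖y‖) ^ 2) := by
        apply div_pos (by norm_num)
        have := sq_lt_sq' (by linarith [neg_abs_le (2 * τ * ‖y‖), abs_nonneg (2 * τ * ‖y‖)])
          ((le_abs_self _).trans_lt hB)
        linarith
      linarith
    · exact ae_of_all _ fun u => by positivity
  simp only [weightWave, h1]
  rw [lintegral_sphere_inner (h := fun u => ENNReal.ofReal ((A + 2 * τ * u) ^ 2)⁻¹) (by fun_prop),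
    h2, ← ENNReal.ofReal_mul (by positivity), ← ENNReal.ofReal_mul (by positivity)]
  congr 1
  have h3 : A ^ 2 - (2 * τ * ‖y‖) ^ 2 = (1 + (‖y‖ - τ) ^ 2) * (1 + (‖y‖ + τ) ^ 2) := by
    simp only [A]
    ring
  rw [h3]
  have : 0 < (1 + (‖y‖ - τ) ^ 2) * (1 + (‖y‖ + τ) ^ 2) := by positivity
  field_simp
  ring

/-- With P = 1 + (r - τ)² and Q = 1 + (r + τ)², both τ² and 1 + r² are at most Q, and P ≤ P⁴. The
bound is integrable in τ uniformly in y, and then in y. -/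
theorem weightWave_pow_four_le {τ : ℝ} (hτ : 0 < τ) (y : Space) :
    weightWave (τ, y) ^ (4 : ℝ) ≤
      weight y * ENNReal.ofReal (1 + (‖y‖ - τ) ^ 2)⁻¹ := by
  rw [weightWave_eq hτ, ENNReal.ofReal_rpow_of_nonneg (by positivity) (by norm_num), weight,
    ← ENNReal.ofReal_mul (by positivity)]
  refine ENNReal.ofReal_le_ofReal ?_
  rw [show (4 : ℝ) = ((4 : ℕ) : ℝ) by norm_num, Real.rpow_natCast, ← mul_inv, div_pow,
    ← one_div, div_le_div_iff₀ (by positivity) (by positivity), one_mul]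
  set r := ‖y‖
  have hr : 0 ≤ r := norm_nonneg y
  set P := 1 + (r - τ) ^ 2
  set Q := 1 + (r + τ) ^ 2
  have hP : 1 ≤ P := by simp only [P]; nlinarith [sq_nonneg (r - τ)]
  have h1 : τ ^ 2 ≤ Q := by simp only [Q]; nlinarith
  have h2 : 1 + r ^ 2 ≤ Q := by simp only [Q]; nlinarith
  have h3 : τ ^ 2 * (1 + r ^ 2) ≤ Q * Q := by gcongr
  calc τ ^ 4 * ((1 + r ^ 2) ^ 2 * P) = P * (τ ^ 2 * (1 + r ^ 2)) ^ 2 := by ring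
    _ ≤ P ^ 4 * (Q * Q) ^ 2 := by
        gcongr
        exact le_self_pow₀ hP (by norm_num)
    _ = (P * Q) ^ 4 := by ring

theorem lintegral_weightWave_lt_top :
    ∫⁻ p, weightWave p ^ (4 : ℝ) ∂((volume.restrict (Ioi (0 : ℝ))).prod (volume : Measure Space))
      < ∞ := by
  rw [lintegral_prod_symm _ (measurable_weightWave.pow_const _).aemeasurable]
  have hweight : ∫⁻ y, weight y < ∞ := by
    have h := integrable_rpow_neg_one_add_norm_sq (E := Space) (μ := volume) (r := 4)
      (by simp; norm_num)
    have h2 : Integrable (fun y : Space => ((1 + ‖y‖ ^ 2) ^ 2)⁻¹) := by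
      refine h.congr (ae_of_all _ fun y => ?_)
      simp only
      rw [show (-4 / 2 : ℝ) = -((2 : ℕ) : ℝ) by norm_num, Real.rpow_neg (by positivity),
        Real.rpow_natCast]
    exact h2.lintegral_lt_top
  have hline : ∫⁻ τ : ℝ, ENNReal.ofReal (1 + τ ^ 2)⁻¹ < ∞ :=
    integrable_inv_one_add_sq.lintegral_lt_top
  calc ∫⁻ y : Space, ∫⁻ τ in Ioi (0 : ℝ), weightWave (τ, y) ^ (4 : ℝ)
      ≤ ∫⁻ y : Space, ∫⁻ τ : ℝ, weight y * ENNReal.ofReal (1 + (‖y‖ - τ) ^ 2)⁻¹ := by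
        refine lintegral_mono fun y => ?_
        refine (setLIntegral_mono' measurableSet_Ioi fun τ hτ => weightWave_pow_four_le hτ y).trans ?_
        exact setLIntegral_le_lintegral _ _
    _ = ∫⁻ y, weight y * ∫⁻ τ : ℝ, ENNReal.ofReal (1 + τ ^ 2)⁻¹ := by
        refine lintegral_congr fun y => ?_
        rw [lintegral_const_mul' _ _ (by simp [weight]),
          lintegral_sub_left_eq_self (fun τ : ℝ => ENNReal.ofReal (1 + τ ^ 2)⁻¹)]
    _ < ∞ := by
        rw [lintegral_mul_const _ measurable_weight]
        exact ENNReal.mul_lt_top hweight hline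

/-- Hölder's inequality against `weightWave`, uniformly in time. -/
theorem exists_lintegral_mul_weightWave_le {G : Spacetime → ℝ≥0∞} (hG : Measurable G)
    (hG' : ∫⁻ p, G p ^ (4 / 3 : ℝ) < ∞) :
    ∃ M : ℝ≥0∞, M ≠ ∞ ∧ ∀ t : ℝ,
      ∫⁻ τ in Ioi (0 : ℝ), ∫⁻ y, G (t - τ, y) * weightWave (τ, y) ≤ M := by
  set μ := (volume.restrict (Ioi (0 : ℝ))).prod (volume : Measure Space)
  refine ⟨(∫⁻ p, G p ^ (4 / 3 : ℝ)) ^ (1 / (4 / 3) : ℝ) *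
    (∫⁻ p, weightWave p ^ (4 : ℝ) ∂μ) ^ (1 / 4 : ℝ), ENNReal.mul_ne_top
      (ENNReal.rpow_ne_top_of_nonneg (by norm_num) hG'.ne)
      (ENNReal.rpow_ne_top_of_nonneg (by norm_num) lintegral_weightWave_lt_top.ne), fun t => ?_⟩
  -- Time reversal and translation preserve the L^{4/3} norm, so the bound does not depend on t.
  have hmp : MeasurePreserving (fun p : Spacetime => (t - p.1, p.2)) volume volume :=
    (Measure.measurePreserving_sub_left volume t).prod (MeasurePreserving.id volume)
  have hGt : Measurable fun p : Spacetime => G (t - p.1, p.2) := hG.comp hmp.measurable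
  rw [← lintegral_prod (fun p : Spacetime => G (t - p.1, p.2) * weightWave p)
    (hGt.mul measurable_weightWave).aemeasurable]
  refine (ENNReal.lintegral_mul_le_Lp_mul_Lq μ (p := 4 / 3) (q := 4)
    (Real.holderConjugate_iff.2 ⟨by norm_num, by norm_num⟩)
    hGt.aemeasurable measurable_weightWave.aemeasurable).trans ?_
  gcongr ?_ ^ _ * _
  rw [← hmp.lintegral_comp (hG.pow_const _)]
  refine lintegral_mono' ?_ le_rfl
  rw [Measure.volume_eq_prod]
  exact Measure.prod_mono Measure.restrict_le_self le_rfl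

/-- Tonelli and the translation x = y + τω move the average over the backward cone from G onto the
weight. -/
theorem lintegral_weight_mul_lintegral_cone {G : Spacetime → ℝ≥0∞} (hG : Measurable G) (t : ℝ) :
    ∫⁻ x, weight x * ∫⁻ p, G (t - p.1, x - p.1 • (p.2 : Space)) ∂conePolarMeasure =
      ∫⁻ τ in Ioi (0 : ℝ), ∫⁻ y, G (t - τ, y) * weightWave (τ, y) := by
  have hw := measurable_weight
  calc ∫⁻ x, weight x * ∫⁻ p, G (t - p.1, x - p.1 • (p.2 : Space)) ∂conePolarMeasure
      = ∫⁻ x, ∫⁻ p, weight x * G (t - p.1, x - p.1 • (p.2 : Space)) ∂conePolarMeasure := by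
        refine lintegral_congr fun x => ?_
        rw [lintegral_const_mul' _ _ (by simp [weight])]
    _ = ∫⁻ p, (∫⁻ x, weight x * G (t - p.1, x - p.1 • (p.2 : Space))) ∂conePolarMeasure :=
        lintegral_lintegral_swap (by fun_prop)
    _ = ∫⁻ p, (∫⁻ y, weight (y + p.1 • (p.2 : Space)) * G (t - p.1, y)) ∂conePolarMeasure := by
        refine lintegral_congr fun p => ?_
        rw [← lintegral_add_right_eq_self _ (p.1 • (p.2 : Space))]
        simp
    _ = ∫⁻ τ in Ioi (0 : ℝ), ENNReal.ofReal (τ / (4 * Real.pi)) *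
          ∫⁻ ω, (∫⁻ y, weight (y + τ • (ω : Space)) * G (t - τ, y)) ∂sphereMeasure := by
        have : Measurable fun q : (ℝ × Metric.sphere (0 : Space) 1) × Space =>
            weight (q.2 + q.1.1 • (q.1.2 : Space)) * G (t - q.1.1, q.2) := by fun_prop
        exact lintegral_conePolarMeasure this.lintegral_prod_right'
    _ = _ := by
        refine lintegral_congr fun τ => ?_
        rw [lintegral_lintegral_swap (by fun_prop), ← lintegral_const_mul' _ _ ENNReal.ofReal_ne_top]
        refine lintegral_congr fun y => ?_
        rw [lintegral_mul_const _ (by fun_prop), weightWave, mul_comm (G _), mul_assoc]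

/-! ### The retarded potential: local integrability and Fubini bounds. -/

/-- The retarded potential: convolution with the forward fundamental solution. -/
def retardedPotential (F : Spacetime → ℂ) (p : Spacetime) : ℂ :=
  ∫ q, F (p - q) ∂coneMeasure

theorem retardedPotential_eq {F : Spacetime → ℂ} (hF : StronglyMeasurable F) (p : Spacetime) :
    retardedPotential F p =
      ∫ q, F (p.1 - q.1, p.2 - q.1 • (q.2 : Space)) ∂conePolarMeasure := by
  have h : StronglyMeasurable fun q => F (p - q) := hF.comp_measurable (by fun_prop)
  rw [retardedPotential, coneMeasure, integral_map (by fun_prop) h.aestronglyMeasurable]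
  rfl

theorem stronglyMeasurable_retardedPotential {F : Spacetime → ℂ} (hF : StronglyMeasurable F) :
    StronglyMeasurable (retardedPotential F) := by
  have : StronglyMeasurable fun q : Spacetime × Spacetime => F (q.1 - q.2) :=
    hF.comp_measurable (by fun_prop)
  exact this.integral_prod_right'

theorem enorm_retardedPotential_le {F : Spacetime → ℂ} (hF : StronglyMeasurable F)
    (p : Spacetime) : ‖retardedPotential F p‖ₑ ≤
      ∫⁻ q, ‖F (p.1 - q.1, p.2 - q.1 • (q.2 : Space))‖ₑ ∂conePolarMeasure := by
  rw [retardedPotential_eq hF]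
  exact enorm_integral_le_lintegral_enorm _

variable {F : Spacetime → ℂ}

theorem exists_lintegral_weight_mul_cone_le (hm : StronglyMeasurable F)
    (hF : MemLp F (4 / 3) volume) :
    ∃ M : ℝ≥0∞, M ≠ ∞ ∧ ∀ t : ℝ,
      ∫⁻ x, weight x * ∫⁻ p, ‖F (t - p.1, x - p.1 • (p.2 : Space))‖ₑ ∂conePolarMeasure ≤ M := by
  have hG : Measurable fun p => ‖F p‖ₑ := hm.measurable.enorm
  have hG' : ∫⁻ p, ‖F p‖ₑ ^ (4 / 3 : ℝ) < ∞ := by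
    have := lintegral_rpow_enorm_lt_top_of_eLpNorm_lt_top (p := 4 / 3) (by simp)
      (ENNReal.div_ne_top (by simp) (by simp)) hF.2
    simpa using this
  obtain ⟨M, hM, h⟩ := exists_lintegral_mul_weightWave_le hG hG'
  exact ⟨M, hM, fun t => (lintegral_weight_mul_lintegral_cone hG t).trans_le (h t)⟩

/-- The weight is bounded below on balls, so the weighted bound, uniform in t, integrates over
bounded time intervals. -/
theorem locallyIntegrable_retardedPotential (hm : StronglyMeasurable F)
    (hF : MemLp F (4 / 3) volume) : LocallyIntegrable (retardedPotential F) volume := by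
  obtain ⟨M, hM, h⟩ := exists_lintegral_weight_mul_cone_le hm hF
  intro p
  refine ⟨Icc (p.1 - 1) (p.1 + 1) ×ˢ Metric.closedBall p.2 1, ?_, ?_⟩
  · exact prod_mem_nhds (Icc_mem_nhds (by linarith) (by linarith))
      (Metric.closedBall_mem_nhds _ one_pos)
  · refine ⟨(stronglyMeasurable_retardedPotential hm).aestronglyMeasurable, ?_⟩
    have hmeas := (stronglyMeasurable_retardedPotential hm).measurable.enorm
    set R := ‖p.2‖ + 1
    set C : ℝ≥0∞ := ENNReal.ofReal ((1 + R ^ 2) ^ 2)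
    have hC : ∀ x ∈ Metric.closedBall p.2 1, 1 ≤ C * weight x := by
      intro x hx
      have hxR : ‖x‖ ≤ R := by
        have := norm_le_norm_add_norm_sub' x p.2
        rw [mem_closedBall_iff_norm] at hx
        linarith
      rw [weight, ← ENNReal.ofReal_mul (by positivity), ENNReal.one_le_ofReal, ← div_eq_mul_inv,
        one_le_div (by positivity)]
      gcongr
    have hslice : ∀ t, ∫⁻ x in Metric.closedBall p.2 1, ‖retardedPotential F (t, x)‖ₑ ≤ C * M := by
      intro t
      calc ∫⁻ x in Metric.closedBall p.2 1, ‖retardedPotential F (t, x)‖ₑ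
          ≤ ∫⁻ x in Metric.closedBall p.2 1, C * (weight x *
            ∫⁻ q, ‖F (t - q.1, x - q.1 • (q.2 : Space))‖ₑ ∂conePolarMeasure) := by
            refine setLIntegral_mono' Metric.isClosed_closedBall.measurableSet fun x hx => ?_
            rw [← mul_assoc]
            exact (enorm_retardedPotential_le hm (t, x)).trans (le_mul_of_one_le_left' (hC x hx))
        _ ≤ ∫⁻ x, C * (weight x *
            ∫⁻ q, ‖F (t - q.1, x - q.1 • (q.2 : Space))‖ₑ ∂conePolarMeasure) :=
            setLIntegral_le_lintegral _ _
        _ ≤ C * M := by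
            rw [lintegral_const_mul' _ _ ENNReal.ofReal_ne_top]
            gcongr
            exact h t
    rw [HasFiniteIntegral, Measure.volume_eq_prod, ← Measure.prod_restrict,
      lintegral_prod _ hmeas.aemeasurable]
    refine (lintegral_mono hslice).trans_lt ?_
    rw [lintegral_const]
    exact ENNReal.mul_lt_top (ENNReal.mul_lt_top ENNReal.ofReal_lt_top hM.lt_top)
      (by simp)

theorem integrable_schwartz_mul_cone (hm : StronglyMeasurable F)
    (hF : MemLp F (4 / 3) volume) (t : ℝ) (φ : 𝓢(Space, ℂ)) :
    Integrable (fun p : Space × (ℝ × Metric.sphere (0 : Space) 1) =>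
      φ p.1 * F (t - p.2.1, p.1 - p.2.1 • (p.2.2 : Space))) (volume.prod conePolarMeasure) := by
  obtain ⟨M, hM, h⟩ := exists_lintegral_weight_mul_cone_le hm hF
  obtain ⟨C, hC, hφ⟩ := exists_enorm_le_weight φ
  have hFm := hm.measurable
  have hφm := φ.continuous.measurable
  have hmeas : Measurable (fun p : Space × (ℝ × Metric.sphere (0 : Space) 1) =>
      φ p.1 * F (t - p.2.1, p.1 - p.2.1 • (p.2.2 : Space))) := by fun_prop
  refine ⟨hmeas.aestronglyMeasurable, ?_⟩
  rw [HasFiniteIntegral, lintegral_prod _ hmeas.enorm.aemeasurable]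
  calc ∫⁻ x, ∫⁻ p, ‖φ x * F (t - p.1, x - p.1 • (p.2 : Space))‖ₑ ∂conePolarMeasure
      ≤ ∫⁻ x, C * (weight x *
          ∫⁻ p, ‖F (t - p.1, x - p.1 • (p.2 : Space))‖ₑ ∂conePolarMeasure) := by
        refine lintegral_mono fun x => ?_
        simp only [enorm_mul]
        rw [lintegral_const_mul' _ _ enorm_ne_top, ← mul_assoc]
        gcongr
        exact hφ x
    _ ≤ C * M := by
        rw [lintegral_const_mul' _ _ hC]
        gcongr
        exact h t
    _ < ∞ := ENNReal.mul_lt_top hC.lt_top hM.lt_top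

/-- For almost every delay `τ`, the double integral defining the Kirchhoff pairing converges. -/
theorem ae_integrable_schwartz_mul_sphere (hm : StronglyMeasurable F)
    (hF : MemLp F (4 / 3) volume) (t : ℝ) (φ : 𝓢(Space, ℂ)) :
    ∀ᵐ τ ∂(volume.restrict (Ioi (0 : ℝ))),
      Integrable (fun p : Metric.sphere (0 : Space) 1 × Space =>
        φ (p.2 + τ • (p.1 : Space)) * F (t - τ, p.2)) (sphereMeasure.prod volume) := by
  obtain ⟨M, hM, h⟩ := exists_lintegral_weight_mul_cone_le hm hF
  obtain ⟨C, hC, hφ⟩ := exists_enorm_le_weight φ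
  have hFm := hm.measurable
  have hφm := φ.continuous.measurable
  have hw := measurable_weight
  have hG : Measurable fun p => ‖F p‖ₑ := hFm.enorm
  have hWm := measurable_weightWave
  have h1 := (lintegral_weight_mul_lintegral_cone hG t).symm.trans_le (h t)
  have h2 : Measurable fun τ : ℝ => ∫⁻ y, ‖F (t - τ, y)‖ₑ * weightWave (τ, y) := by
    have : Measurable fun q : Spacetime => ‖F (t - q.1, q.2)‖ₑ * weightWave q := by fun_prop
    exact this.lintegral_prod_right'
  filter_upwards [ae_lt_top h2 (h1.trans_lt hM.lt_top).ne, ae_restrict_mem measurableSet_Ioi]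
    with τ hτ hpos
  have hpos : 0 < τ := hpos
  have hmeas : Measurable (fun p : Metric.sphere (0 : Space) 1 × Space =>
        φ (p.2 + τ • (p.1 : Space)) * F (t - τ, p.2)) := by fun_prop
  refine ⟨hmeas.aestronglyMeasurable, ?_⟩
  rw [HasFiniteIntegral, lintegral_prod_symm _ hmeas.enorm.aemeasurable]
  have h3 : ∫⁻ y, ‖F (t - τ, y)‖ₑ * weightWave (τ, y) = ENNReal.ofReal (τ / (4 * Real.pi)) *
      ∫⁻ y, ‖F (t - τ, y)‖ₑ * ∫⁻ ω, weight (y + τ • (ω : Space)) ∂sphereMeasure := by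
    rw [← lintegral_const_mul' _ _ ENNReal.ofReal_ne_top]
    refine lintegral_congr fun y => ?_
    rw [weightWave]
    ring
  rw [h3] at hτ
  have h4 : ∫⁻ y, ‖F (t - τ, y)‖ₑ * ∫⁻ ω, weight (y + τ • (ω : Space)) ∂sphereMeasure < ∞ := by
    -- The factor τ/(4π) is nonzero since τ > 0, so finiteness of the product passes to the
    -- integral.
    refine lt_of_le_of_ne le_top fun htop => ?_
    rw [htop, ENNReal.mul_top (by simpa using by positivity)] at hτ
    exact hτ.ne rfl
  calc ∫⁻ y, ∫⁻ ω, ‖φ (y + τ • (ω : Space)) * F (t - τ, y)‖ₑ ∂sphereMeasure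
      ≤ ∫⁻ y, C * (‖F (t - τ, y)‖ₑ * ∫⁻ ω, weight (y + τ • (ω : Space)) ∂sphereMeasure) := by
        refine lintegral_mono fun y => ?_
        simp only [enorm_mul]
        rw [lintegral_mul_const' _ _ enorm_ne_top, mul_left_comm, mul_comm]
        gcongr
        rw [← lintegral_const_mul' _ _ hC]
        exact lintegral_mono fun ω => hφ _
    _ < ∞ := by
        rw [lintegral_const_mul' _ _ hC]
        exact ENNReal.mul_lt_top hC.lt_top h4

variable {F : Spacetime → ℂ}

/-! ### Duhamel's integral as the pairing with the retarded potential. -/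

theorem ae_memLp_slice (hF : MemLp F (4 / 3) volume) :
    ∀ᵐ s : ℝ, MemLp (fun y => F (s, y)) (4 / 3) (volume : Measure Space) := by
  have h0 : (4 / 3 : ℝ≥0∞) ≠ 0 := by simp
  have h1 : (4 / 3 : ℝ≥0∞) ≠ ∞ := ENNReal.div_ne_top (by simp) (by simp)
  have hfin := lintegral_rpow_enorm_lt_top_of_eLpNorm_lt_top h0 h1 hF.2
  have hm : AEStronglyMeasurable F ((volume : Measure ℝ).prod (volume : Measure Space)) := hF.1
  rw [Measure.volume_eq_prod, lintegral_prod _ (hm.enorm.pow_const _)] at hfin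
  filter_upwards [hm.prodMk_left, ae_lt_top' (hm.enorm.pow_const _).lintegral_prod_right' hfin.ne]
    with s hs1 hs2
  exact ⟨hs1, (eLpNorm_lt_top_iff_lintegral_rpow_enorm_lt_top h0 h1).2 hs2⟩

theorem ae_duhamelIntegrand_eq (hF : MemLp F (4 / 3) volume) (t : ℝ) (φ : 𝓢(Space, ℂ)) :
    ∀ᵐ s : ℝ, duhamelIntegrand F t φ s = ∫ y, kirchhoff φ (t - s) y * F (s, y) := by
  filter_upwards [ae_memLp_slice hF] with s hs
  rw [duhamelIntegrand, slice, dif_pos hs, wavePropagator_toLp]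

/-- Duhamel's integral converges and is the pairing with the retarded potential. -/
theorem duhamel (hm : StronglyMeasurable F) (hF : MemLp F (4 / 3) volume) (t : ℝ)
    (φ : 𝓢(Space, ℂ)) :
    IntegrableOn (duhamelIntegrand F t φ) (Iio t) ∧
      Integrable (fun x => φ x * retardedPotential F (t, x)) ∧
      ∫ x, φ x * retardedPotential F (t, x) = antiboxAt F t φ := by
  have hI := integrable_schwartz_mul_cone hm hF t φ
  let J : ℝ × Metric.sphere (0 : Space) 1 → ℂ := fun p =>
    ∫ y, φ (y + p.1 • (p.2 : Space)) * F (t - p.1, y)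
  let K : ℝ → ℂ := fun τ => ∫ ω, J (τ, ω) ∂sphereMeasure
  have hφw : ∀ x, φ x * retardedPotential F (t, x) =
      ∫ p, φ x * F (t - p.1, x - p.1 • (p.2 : Space)) ∂conePolarMeasure := fun x => by
    rw [retardedPotential_eq hm, integral_const_mul]
  have hJ_eq : ∀ p : ℝ × Metric.sphere (0 : Space) 1,
      ∫ x, φ x * F (t - p.1, x - p.1 • (p.2 : Space)) = J p := fun p => by
    rw [← integral_add_right_eq_self _ (p.1 • (p.2 : Space))]
    simp [J]
  have hJ : Integrable J conePolarMeasure :=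
    hI.integral_prod_right.congr (ae_of_all _ hJ_eq)
  have hpair : ∫ x, φ x * retardedPotential F (t, x) = ∫ p, J p ∂conePolarMeasure := by
    simp_rw [hφw, ← hJ_eq]
    exact integral_integral_swap hI
  have hd : Measurable fun τ : ℝ => (τ / (4 * Real.pi)).toNNReal := by fun_prop
  have hK : Integrable (fun τ => (τ / (4 * Real.pi)).toNNReal • K τ)
      (volume.restrict (Ioi (0 : ℝ))) :=
    (integrable_withDensity_iff_integrable_smul hd).1 hJ.integral_prod_left
  have hKint : ∫ p, J p ∂conePolarMeasure =
      ∫ τ in Ioi (0 : ℝ), (τ / (4 * Real.pi)).toNNReal • K τ := by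
    rw [conePolarMeasure, integral_prod _ hJ]
    exact integral_withDensity_eq_integral_smul hd _
  have hmp : MeasurePreserving (fun τ : ℝ => t - τ) volume volume :=
    Measure.measurePreserving_sub_left volume t
  -- With s = t - τ, Kirchhoff's formula and Fubini on S² × ℝ³ identify the Duhamel integrand with
  -- the cone integral at delay τ.
  have hDK : (fun τ => duhamelIntegrand F t φ (t - τ)) =ᵐ[volume.restrict (Ioi (0 : ℝ))]
      fun τ => (τ / (4 * Real.pi)).toNNReal • K τ := by
    filter_upwards [ae_integrable_schwartz_mul_sphere hm hF t φ,
      ae_restrict_of_ae (hmp.quasiMeasurePreserving.ae (ae_duhamelIntegrand_eq hF t φ)),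
      ae_restrict_mem measurableSet_Ioi] with τ h1 h2 h3
    have h3 : 0 < τ := h3
    rw [h2, sub_sub_cancel, NNReal.smul_def, Real.coe_toNNReal _ (by positivity),
      Complex.real_smul]
    simp only [K, J, kirchhoff, mul_assoc]
    rw [integral_integral_swap h1, integral_const_mul]
    congr 1
    refine integral_congr_ae (ae_of_all _ fun y => ?_)
    simp only
    rw [integral_mul_const]
  have hpre : (fun τ : ℝ => t - τ) ⁻¹' Iio t = Ioi 0 := by
    ext τ
    simp
  have hemb : MeasurableEmbedding (fun τ : ℝ => t - τ) :=
    (MeasurableEquiv.subLeft t).measurableEmbedding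
  refine ⟨?_, ?_, ?_⟩
  · rw [← hmp.integrableOn_comp_preimage hemb, hpre]
    exact hK.congr hDK.symm
  · simp_rw [hφw]
    exact hI.integral_prod_left
  · rw [hpair, hKint, antiboxAt, ← hmp.setIntegral_preimage_emb hemb _ (Iio t), hpre]
    exact (integral_congr_ae hDK).symm

theorem isAntibox_retardedPotential (hm : StronglyMeasurable F) (hF : MemLp F (4 / 3) volume) :
    IsAntibox F (retardedPotential F) :=
  ⟨locallyIntegrable_retardedPotential hm hF,
    ae_of_all _ fun t φ => (duhamel hm hF t φ).2⟩

/-! ### Independence of representatives and uniqueness. -/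

theorem ae_slice_congr {β : Type*} {f g : Spacetime → β} (h : f =ᵐ[volume] g) :
    ∀ᵐ s : ℝ, (fun y => f (s, y)) =ᵐ[volume] fun y => g (s, y) :=
  Measure.ae_ae_of_ae_prod h

theorem slice_congr {F' : Spacetime → ℂ} {s : ℝ}
    (h : (fun y => F (s, y)) =ᵐ[volume] fun y => F' (s, y)) : slice F s = slice F' s := by
  unfold slice
  by_cases hs : MemLp (fun y => F (s, y)) (4 / 3) (volume : Measure Space)
  · rw [dif_pos hs, dif_pos ((memLp_congr_ae h).1 hs), (MemLp.toLp_eq_toLp_iff _ _).2 h]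
  · rw [dif_neg hs, dif_neg fun h' => hs ((memLp_congr_ae h).2 h')]

theorem duhamelIntegrand_congr {F' : Spacetime → ℂ} (h : F =ᵐ[volume] F') (t : ℝ)
    (φ : 𝓢(Space, ℂ)) : duhamelIntegrand F t φ =ᵐ[volume] duhamelIntegrand F' t φ := by
  filter_upwards [ae_slice_congr h] with s hs
  rw [duhamelIntegrand, duhamelIntegrand, slice_congr hs]

theorem antiboxAt_congr {F' : Spacetime → ℂ} (h : F =ᵐ[volume] F') (t : ℝ) (φ : 𝓢(Space, ℂ)) :
    antiboxAt F t φ = antiboxAt F' t φ :=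
  integral_congr_ae (ae_restrict_of_ae (duhamelIntegrand_congr h t φ))

theorem IsAntibox.congr {F' w w' : Spacetime → ℂ} (h : IsAntibox F w) (hF : F =ᵐ[volume] F')
    (hw : w =ᵐ[volume] w') : IsAntibox F' w' := by
  refine ⟨h.1.congr hw, ?_⟩
  filter_upwards [h.2, ae_slice_congr hw] with t ht hwt φ
  have : (fun x => φ x * w (t, x)) =ᵐ[volume] fun x => φ x * w' (t, x) := by
    filter_upwards [hwt] with x hx
    rw [hx]
  rw [← antiboxAt_congr hF, ← integral_congr_ae this]
  exact ⟨(ht φ).1.congr this, (ht φ).2⟩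

theorem locallyIntegrable_of_forall_schwartz {f : Space → ℂ}
    (hf : ∀ φ : 𝓢(Space, ℂ), Integrable fun x => φ x * f x) : LocallyIntegrable f volume := by
  intro x
  let b : ContDiffBump x := ⟨1, 2, one_pos, one_lt_two⟩
  have hb : ContDiff ℝ (↑(⊤ : ℕ∞)) fun y => (b y : ℂ) := Complex.ofRealCLM.contDiff.comp b.contDiff
  have hbc : HasCompactSupport fun y => (b y : ℂ) :=
    b.hasCompactSupport.comp_left (g := fun r : ℝ => (r : ℂ)) rfl
  refine ⟨Metric.closedBall x 1, Metric.closedBall_mem_nhds x one_pos,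
    (hf (hbc.toSchwartzMap hb)).integrableOn.congr_fun (fun y hy => ?_)
      Metric.isClosed_closedBall.measurableSet⟩
  have hby : b y = 1 := b.one_of_mem_closedBall hy
  change (b y : ℂ) * f y = f y
  rw [hby, Complex.ofReal_one, one_mul]

/-- Functions that are integrable against all Schwartz functions are determined by the
integrals. -/
theorem ae_eq_of_forall_schwartz {f g : Space → ℂ}
    (hf : ∀ φ : 𝓢(Space, ℂ), Integrable fun x => φ x * f x)
    (hg : ∀ φ : 𝓢(Space, ℂ), Integrable fun x => φ x * g x)
    (h : ∀ φ : 𝓢(Space, ℂ), ∫ x, φ x * f x = ∫ x, φ x * g x) : f =ᵐ[volume] g := by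
  have hloc : LocallyIntegrable (fun x => f x - g x) volume :=
    (locallyIntegrable_of_forall_schwartz hf).sub (locallyIntegrable_of_forall_schwartz hg)
  have h0 : ∀ᵐ x ∂(volume : Measure Space), f x - g x = 0 := by
    refine ae_eq_zero_of_integral_contDiff_smul_eq_zero hloc fun ψ hψ hψc => ?_
    have hψ' : ContDiff ℝ (↑(⊤ : ℕ∞)) fun x => (ψ x : ℂ) := Complex.ofRealCLM.contDiff.comp hψ
    have hψc' : HasCompactSupport fun x => (ψ x : ℂ) :=
      hψc.comp_left (g := fun r : ℝ => (r : ℂ)) rfl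
    let φ : 𝓢(Space, ℂ) := hψc'.toSchwartzMap hψ'
    have hφ : ∀ x, ψ x • (f x - g x) = φ x * f x - φ x * g x := fun x => by
      rw [Complex.real_smul, mul_sub]
      rfl
    simp_rw [hφ]
    rw [integral_sub (hf φ) (hg φ), h φ, sub_self]
  filter_upwards [h0] with x hx
  exact sub_eq_zero.1 hx

theorem IsAntibox.ae_eq {w w' : Spacetime → ℂ} (h : IsAntibox F w) (h' : IsAntibox F w') :
    w =ᵐ[volume] w' := by
  have hw := h.1.aestronglyMeasurable
  have hw' := h'.1.aestronglyMeasurable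
  have hslice : ∀ᵐ t : ℝ, (fun x => w (t, x)) =ᵐ[volume] fun x => w' (t, x) := by
    filter_upwards [h.2, h'.2] with t ht ht'
    exact ae_eq_of_forall_schwartz (fun φ => (ht φ).1) (fun φ => (ht' φ).1)
      fun φ => (ht φ).2.trans (ht' φ).2.symm
  -- Passing from almost every slice to almost every point needs a measurable coincidence set, hence
  -- measurable representatives.
  have hmk : hw.mk w =ᵐ[volume] hw'.mk w' := by
    have hmeas : MeasurableSet {p | hw.mk w p = hw'.mk w' p} :=
      measurableSet_eq_fun hw.stronglyMeasurable_mk.measurable hw'.stronglyMeasurable_mk.measurable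
    refine (Measure.ae_prod_iff_ae_ae hmeas).2 ?_
    filter_upwards [hslice, ae_slice_congr hw.ae_eq_mk, ae_slice_congr hw'.ae_eq_mk]
      with t h1 h2 h3
    exact h2.symm.trans (h1.trans h3)
  exact hw.ae_eq_mk.trans (hmk.trans hw'.ae_eq_mk.symm)

/-! ### Composition with boosts and the conclusion. -/

variable {α : ℝ} (hα : α ∈ Ioo (-1 : ℝ) 1)

theorem det_boost_ne_zero :
    LinearMap.det ((boost α hα).toLinearEquiv : Spacetime →ₗ[ℝ] Spacetime) ≠ 0 :=
  (LinearEquiv.isUnit_det' _).ne_zero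

instance isAddHaarMeasure_spacetime : (volume : Measure Spacetime).IsAddHaarMeasure :=
  inferInstanceAs ((volume : Measure ℝ).prod (volume : Measure Space)).IsAddHaarMeasure

theorem quasiMeasurePreserving_boost :
    Measure.QuasiMeasurePreserving (boost α hα) volume volume :=
  Measure.LinearMap.quasiMeasurePreserving volume _ (det_boost_ne_zero hα)

/-- Invertibility suffices: a linear isomorphism scales Lebesgue measure by a finite constant. -/
theorem memLp_comp_boost (hF : MemLp F (4 / 3) volume) :
    MemLp (F ∘ boost α hα) (4 / 3) volume := by
  have hmap := Measure.map_linearMap_addHaar_eq_smul_addHaar (volume : Measure Spacetime)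
    (det_boost_ne_zero hα)
  have h := hF.smul_measure
    (c := ENNReal.ofReal |(LinearMap.det ((boost α hα).toLinearEquiv :
      Spacetime →ₗ[ℝ] Spacetime))⁻¹|) ENNReal.ofReal_ne_top
  rw [← hmap] at h
  exact h.comp_of_map (boost α hα).continuous.measurable.aemeasurable

/-- By linearity F(L(p - q)) = F(Lp - Lq), and the cone measure is invariant under q ↦ Lq. -/
theorem retardedPotential_comp_boost (F : Spacetime → ℂ) :
    retardedPotential (F ∘ boost α hα) = retardedPotential F ∘ boost α hα := by
  ext p
  have hemb : MeasurableEmbedding (boost α hα) :=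
    (boost α hα).toHomeomorph.measurableEmbedding
  simp only [retardedPotential, Function.comp_apply, map_sub]
  exact (measurePreserving_boost_coneMeasure hα).integral_comp hemb
    fun q => F (boost α hα p - q)

end LorentzWave

end

theorem lemma3p1 (F : LorentzWave.Spacetime → ℂ) (hF : MemLp F (4 / 3) volume)
    (α : ℝ) (hα : α ∈ Ioo (-1 : ℝ) 1) :
    -- for every `t`, the integrals that define `□⁻¹F(t, ·)` and `□⁻¹(F ∘ L^α)(t, ·)` converge
    -- absolutely
    (∀ (t : ℝ) (φ : 𝓢(LorentzWave.Space, ℂ)),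
      IntegrableOn (LorentzWave.duhamelIntegrand F t φ) (Iio t) ∧
      IntegrableOn (LorentzWave.duhamelIntegrand (F ∘ LorentzWave.boost α hα) t φ) (Iio t)) ∧
    -- `□⁻¹F` is a function
    (∃ w : LorentzWave.Spacetime → ℂ, LorentzWave.IsAntibox F w) ∧
    -- `□⁻¹(F ∘ L^α) = (□⁻¹F) ∘ L^α`
    (∀ w : LorentzWave.Spacetime → ℂ, LorentzWave.IsAntibox F w →
      LorentzWave.IsAntibox (F ∘ LorentzWave.boost α hα) (w ∘ LorentzWave.boost α hα) ∧
      ∀ w' : LorentzWave.Spacetime → ℂ,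
        LorentzWave.IsAntibox (F ∘ LorentzWave.boost α hα) w' →
          w' =ᵐ[volume] w ∘ LorentzWave.boost α hα) := by
  have hqmp := LorentzWave.quasiMeasurePreserving_boost hα
  -- The retarded potential at a point samples F on a null set, a cone, so it is formed from a
  -- strongly measurable representative.
  set G := hF.1.mk F
  have hFG : F =ᵐ[volume] G := hF.1.ae_eq_mk
  have hGm : StronglyMeasurable G := hF.1.stronglyMeasurable_mk
  have hG : MemLp G (4 / 3) volume := (memLp_congr_ae hFG).1 hF
  have hFGb : F ∘ LorentzWave.boost α hα =ᵐ[volume] G ∘ LorentzWave.boost α hα :=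
    hqmp.ae_eq hFG
  have hGbm : StronglyMeasurable (G ∘ LorentzWave.boost α hα) :=
    hGm.comp_measurable hqmp.measurable
  have hGb := LorentzWave.memLp_comp_boost hα hG
  have hw₀ := (LorentzWave.isAntibox_retardedPotential hGm hG).congr hFG.symm (ae_eq_refl _)
  have hw₁ := (LorentzWave.isAntibox_retardedPotential hGbm hGb).congr hFGb.symm (ae_eq_refl _)
  rw [LorentzWave.retardedPotential_comp_boost] at hw₁
  refine ⟨fun t φ => ⟨?_, ?_⟩, ⟨_, hw₀⟩, fun w hw => ?_⟩
  · exact (LorentzWave.duhamel hGm hG t φ).1.congr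
      (ae_restrict_of_ae (LorentzWave.duhamelIntegrand_congr hFG t φ).symm)
  · exact (LorentzWave.duhamel hGbm hGb t φ).1.congr
      (ae_restrict_of_ae (LorentzWave.duhamelIntegrand_congr hFGb t φ).symm)
  -- By uniqueness w is almost everywhere the retarded potential; the boost pulls null sets back to
  -- null sets.
  · have hwb := hw₁.congr (ae_eq_refl _) (hqmp.ae_eq (hw₀.ae_eq hw))
    exact ⟨hwb, fun w' hw' => hw'.ae_eq hwb⟩
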